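/- Notation. Let $n \ge 1$. For $E \subset \mathbb{R}^n$ write $|E|$ for its Lebesgue measure, $E\Delta F$ for the symmetric difference, $B_R$ for the open ball of radius $R$ centred at the origin, and for $\delta>0$ let $\mathcal{N}_\delta(\partial E) = \{x \in \mathbb{R}^n : \mathrm{dist}(x,\partial E) < \delta\}$. The perimeter of a measurable set is $P(E) = \sup\{\int_E \operatorname{div} X\,dx : X \in C^1_c(\mathbb{R}^n;\mathbb{R}^n),\ |X| \le 1\}$, and $E$ is a set of finite perimeter if it is Lebesgue measurable and $P(E)<\infty$. A set $E$ satisfies the uniform ball condition (UBC) with radius $r>0$ if for every $x \in \partial E$ there are open balls $B_r(x_+) \subset \mathbb{R}^n\setminus E$ and $B_r(x_-) \subset E$ with $x \in \partial B_r(x_+)\cap \partial B_r(x_-)$. Let $\alpha \in [0,\tfrac1n)$. A set of finite perimeter $F$ is a $(\Lambda,\alpha)$-minimizer of the perimeter, $\Lambda \ge 0$, if $$P(F) \le P(G) + \Lambda |F\Delta G|^{1-\alpha}$$ for every set of finite perimeter $G \subset \mathbb{R}^n$. Given $E \subset \mathbb{R}^n$ and $\delta>0$, a set of finite perimeter $F$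 is a constrained $(\Lambda,\alpha)$-minimizer of the perimeter, $\Lambda>0$, if the same inequality holds for every set of finite perimeter $G$ with $G\Delta F \subset \overline{\mathcal{N}_\delta(\partial E)}$ and $|G|=|F|$. Lemma 2.9. For all $n \ge 1$, $\Lambda>0$, $r_0>0$ and $R_0>0$ there is a constant $\Lambda_1 = \Lambda_1(\Lambda, r_0, R_0, n) \ge 0$ with the following property. Let $\alpha \in [0,\tfrac1n)$ and $\delta \in (0, r_0/4)$, let $E \subset B_{R_0} \subset \mathbb{R}^n$ satisfy the UBC with radius $r_0$, and let $F$ be a constrained $(\Lambda,\alpha)$-minimizer of the perimeter (with respect to $E$ and $\delta$) such that $|F| = |E|$ and $F\Delta E \subset \overline{\mathcal{N}_\delta(\partial E)}$. Then $F$ is a $(\Lambda_1,\alpha)$-minimizer of the perimeter (without constraint). -/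

import Mathlib

open MeasureTheory

namespace AlmostMin

/-- The divergence of a vector field on `ℝⁿ`: `∑ i, ∂ᵢ Xᵢ`. -/
noncomputable def divergence {n : ℕ}
    (X : EuclideanSpace ℝ (Fin n) → EuclideanSpace ℝ (Fin n))
    (x : EuclideanSpace ℝ (Fin n)) : ℝ :=
  ∑ i : Fin n, (fderiv ℝ X x (EuclideanSpace.single i 1)) i

/-- The admissible test fields: `X ∈ C¹_c(ℝⁿ; ℝⁿ)` with `|X| ≤ 1` everywhere. -/
structure IsTestField {n : ℕ}
    (X : EuclideanSpace ℝ (Fin n) → EuclideanSpace ℝ (Fin n)) : Prop where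
  contDiff : ContDiff ℝ 1 X
  hasCompactSupport : HasCompactSupport X
  norm_le_one : ∀ x, ‖X x‖ ≤ 1

/-- The De Giorgi perimeter in `ℝⁿ`,
`P(E) = sup { ∫_E div X : X ∈ C¹_c(ℝⁿ; ℝⁿ), |X| ≤ 1 } ∈ [0, ∞]`. -/
noncomputable def perimeter {n : ℕ} (E : Set (EuclideanSpace ℝ (Fin n))) : ENNReal :=
  ⨆ (X : EuclideanSpace ℝ (Fin n) → EuclideanSpace ℝ (Fin n)) (_ : IsTestField X),
    ENNReal.ofReal (∫ x in E, divergence X x)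

/-- Sets of finite perimeter: Lebesgue measurable sets with `P(E) < ∞`. -/
structure HasFinitePerimeter {n : ℕ} (E : Set (EuclideanSpace ℝ (Fin n))) : Prop where
  nullMeasurableSet : NullMeasurableSet E volume
  perimeter_lt_top : perimeter E < ⊤

/-- The uniform ball condition with radius `r`: at every boundary point there are an exterior and
an interior (open) ball of radius `r` touching the boundary at that point. -/
def UniformBallCondition {n : ℕ} (E : Set (EuclideanSpace ℝ (Fin n))) (r : ℝ) : Prop :=
  ∀ x ∈ frontier E, ∃ xp xm : EuclideanSpace ℝ (Fin n),
    Metric.ball xp r ⊆ Eᶜ ∧ Metric.ball xm r ⊆ E ∧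
      x ∈ Metric.sphere xp r ∧ x ∈ Metric.sphere xm r

/-- The closure of the tubular neighbourhood `{x : dist(x, ∂E) < δ}` of `∂E`. -/
def closedTube {n : ℕ} (E : Set (EuclideanSpace ℝ (Fin n))) (δ : ℝ) :
    Set (EuclideanSpace ℝ (Fin n)) :=
  closure (Metric.thickening δ (frontier E))

/-- `F` is a `(Λ, α)`-minimizer of the perimeter, `Λ ≥ 0`, `α ∈ [0, 1/n)`. The inequality is
one in `[0, ∞]`; the competitor `G` may have infinite volume. -/
structure IsMinimizer {n : ℕ} (Λ α : ℝ) (F : Set (EuclideanSpace ℝ (Fin n))) : Prop where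
  nonneg_const : 0 ≤ Λ
  nonneg_exp : 0 ≤ α
  exp_lt : α < 1 / (n : ℝ)
  finitePerimeter : HasFinitePerimeter F
  le : ∀ G : Set (EuclideanSpace ℝ (Fin n)), HasFinitePerimeter G →
    perimeter F ≤ perimeter G + ENNReal.ofReal Λ * volume (symmDiff F G) ^ (1 - α)

/-- `F` is a constrained `(Λ, α)`-minimizer of the perimeter, `Λ > 0`, `α ∈ [0, 1/n)`, with
respect to the closed `δ`-tube around `∂E`: the competitors have the volume of `F` and differ
from `F` only in the tube. -/
structure IsConstrainedMinimizer {n : ℕ} (E : Set (EuclideanSpace ℝ (Fin n))) (δ Λ α : ℝ)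
    (F : Set (EuclideanSpace ℝ (Fin n))) : Prop where
  pos_const : 0 < Λ
  nonneg_exp : 0 ≤ α
  exp_lt : α < 1 / (n : ℝ)
  finitePerimeter : HasFinitePerimeter F
  le : ∀ G : Set (EuclideanSpace ℝ (Fin n)), HasFinitePerimeter G →
    symmDiff G F ⊆ closedTube E δ → volume G = volume F →
    perimeter F ≤ perimeter G + ENNReal.ofReal Λ * volume (symmDiff F G) ^ (1 - α)

end AlmostMin

namespace AlmostMin

open Filter Topology Set Metric

variable {n : ℕ}

/-! Write m = |F Δ G|. An arbitrary G is turned into an admissible competitor G' with |F Δ G'| ≤ 2m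
and P(G') ≤ P(G) + 3κm, where κ = 2n/r₀ (`exists_constrained_competitor`). Constrained minimality
then gives P(F) ≤ P(G) + 3κm + Λ(2m)^(1-α). If m ≤ 1, then m ≤ m^(1-α) absorbs the linear term. If m
≥ 1, it is enough to bound P(F) by a constant, and the same estimate with G = ∅ does that.

The surgery is cheap by a calibration: inside a ball of radius s and centre c, a test field may be
replaced by -(x - c)/s, of norm at most 1 and divergence -n/s. Hence removing any union of balls of
radius s costs at most n/s times the removed volume (`perimeter_diff_thickening_le`); adding one is
the same statement for complements.

The balls come from the UBC. Concentric with the balls of radius r₀ inside E, those of radius r₀ - δ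
cover E off the tube without entering the tube, while those of radius r₀ + δ stay in E together with
the tube and cover almost all of F. The same holds for Eᶜ. The smaller radius restores E off the
tube; a radius t between the two, found by continuity of the volume in t, corrects the volume. -/

/-! ### Divergence calculus. -/

lemma divergence_smul {φ : EuclideanSpace ℝ (Fin n) → ℝ}
    {X : EuclideanSpace ℝ (Fin n) → EuclideanSpace ℝ (Fin n)} {x : EuclideanSpace ℝ (Fin n)}
    (hφ : DifferentiableAt ℝ φ x) (hX : DifferentiableAt ℝ X x) :
    divergence (fun y ↦ φ y • X y) x = φ x * divergence X x + fderiv ℝ φ x (X x) := by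
  have hsum : X x = ∑ i, X x i • EuclideanSpace.single i (1 : ℝ) := by
    ext j
    simp [Finset.sum_apply, Pi.single_apply]
  simp only [divergence]
  rw [fderiv_fun_smul hφ hX]
  simp only [add_apply, smul_apply,
    ContinuousLinearMap.smulRight_apply, PiLp.add_apply, PiLp.smul_apply, smul_eq_mul,
    Finset.sum_add_distrib, ← Finset.mul_sum]
  congr 1
  conv_rhs => rw [hsum, map_sum]
  simp [mul_comm]

lemma divergence_add {X Y : EuclideanSpace ℝ (Fin n) → EuclideanSpace ℝ (Fin n)}
    {x : EuclideanSpace ℝ (Fin n)} (hX : DifferentiableAt ℝ X x) (hY : DifferentiableAt ℝ Y x) :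
    divergence (fun y ↦ X y + Y y) x = divergence X x + divergence Y x := by
  simp [divergence, fderiv_fun_add hX hY, Finset.sum_add_distrib]

lemma divergence_const_smul (a : ℝ) {X : EuclideanSpace ℝ (Fin n) → EuclideanSpace ℝ (Fin n)}
    {x : EuclideanSpace ℝ (Fin n)} (hX : DifferentiableAt ℝ X x) :
    divergence (fun y ↦ a • X y) x = a * divergence X x := by
  simp [divergence, fderiv_fun_const_smul hX, Finset.mul_sum]

lemma divergence_neg (X : EuclideanSpace ℝ (Fin n) → EuclideanSpace ℝ (Fin n))
    (x : EuclideanSpace ℝ (Fin n)) :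
    divergence (fun y ↦ -X y) x = -divergence X x := by
  simp [divergence, fderiv_fun_neg]

lemma divergence_sub_const (c x : EuclideanSpace ℝ (Fin n)) :
    divergence (fun y ↦ y - c) x = n := by
  simp [divergence, fderiv_sub_const]

lemma continuous_divergence {X : EuclideanSpace ℝ (Fin n) → EuclideanSpace ℝ (Fin n)}
    (hX : ContDiff ℝ 1 X) : Continuous (divergence X) := by
  have := hX.continuous_fderiv one_ne_zero
  unfold divergence
  fun_prop

lemma hasCompactSupport_divergence
    {X : EuclideanSpace ℝ (Fin n) → EuclideanSpace ℝ (Fin n)} (hX : HasCompactSupport X) :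
    HasCompactSupport (divergence X) := by
  refine (hX.fderiv (𝕜 := ℝ)).mono fun x hx h0 ↦ hx ?_
  simp [divergence, h0]

lemma integrable_divergence {X : EuclideanSpace ℝ (Fin n) → EuclideanSpace ℝ (Fin n)}
    (hX : ContDiff ℝ 1 X) (hc : HasCompactSupport X) : Integrable (divergence X) :=
  (continuous_divergence hX).integrable_of_hasCompactSupport (hasCompactSupport_divergence hc)

/-- The divergence theorem for compactly supported fields on the whole space. -/
lemma integral_divergence_eq_zero {X : EuclideanSpace ℝ (Fin n) → EuclideanSpace ℝ (Fin n)}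
    (hX : ContDiff ℝ 1 X) (hc : HasCompactSupport X) : ∫ x, divergence X x = 0 := by
  have hd : Differentiable ℝ X := hX.differentiable one_ne_zero
  have hcont := hX.continuous_fderiv one_ne_zero
  have hi (i : Fin n) : Integrable fun x ↦ (fderiv ℝ X x (EuclideanSpace.single i 1)) i := by
    refine Continuous.integrable_of_hasCompactSupport (by fun_prop)
      ((hc.fderiv (𝕜 := ℝ)).mono fun x hx h0 ↦ hx ?_)
    simp [h0]
  unfold divergence
  rw [integral_finsetSum _ fun i _ ↦ hi i]
  refine Finset.sum_eq_zero fun i _ ↦ ?_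
  have hf (x) : fderiv ℝ (fun y ↦ X y i) x (EuclideanSpace.single i 1)
      = (fderiv ℝ X x (EuclideanSpace.single i 1)) i := by
    have := ((EuclideanSpace.proj (𝕜 := ℝ) i).hasFDerivAt.comp x (hd x).hasFDerivAt).fderiv
    exact congrArg (fun L ↦ L (EuclideanSpace.single i 1)) this
  have key := integral_mul_fderiv_eq_neg_fderiv_mul_of_integrable (μ := volume)
    (f := fun _ : EuclideanSpace ℝ (Fin n) ↦ (1 : ℝ)) (g := fun y ↦ X y i)
    (v := EuclideanSpace.single i 1) (by simp) (by simpa [hf] using hi i)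
    (by
      refine Continuous.integrable_of_hasCompactSupport (by fun_prop) (hc.mono fun x hx h0 ↦ hx ?_)
      simp [h0])
    (fun _ _ ↦ by fun_prop) (fun _ _ ↦ by fun_prop)
  simpa [hf] using key

/-! ### Basic properties of the perimeter. -/

lemma IsTestField.neg {X : EuclideanSpace ℝ (Fin n) → EuclideanSpace ℝ (Fin n)}
    (hX : IsTestField X) : IsTestField fun x ↦ -X x where
  contDiff := hX.contDiff.neg
  hasCompactSupport := hX.hasCompactSupport.mono fun x hx h0 ↦ hx (by simp [h0])
  norm_le_one x := by simpa using hX.norm_le_one x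

lemma ofReal_setIntegral_divergence_le (G : Set (EuclideanSpace ℝ (Fin n)))
    {X : EuclideanSpace ℝ (Fin n) → EuclideanSpace ℝ (Fin n)} (hX : IsTestField X) :
    ENNReal.ofReal (∫ x in G, divergence X x) ≤ perimeter G :=
  le_iSup₂ (f := fun (X : EuclideanSpace ℝ (Fin n) → EuclideanSpace ℝ (Fin n))
    (_ : IsTestField X) ↦ ENNReal.ofReal (∫ x in G, divergence X x)) X hX

lemma setIntegral_divergence_le_mul {G : Set (EuclideanSpace ℝ (Fin n))} (hG : perimeter G ≠ ⊤)
    {Y : EuclideanSpace ℝ (Fin n) → EuclideanSpace ℝ (Fin n)} (hY : ContDiff ℝ 1 Y)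
    (hc : HasCompactSupport Y) {a : ℝ} (ha : 0 < a) (hYa : ∀ x, ‖Y x‖ ≤ a) :
    ∫ x in G, divergence Y x ≤ a * (perimeter G).toReal := by
  have ht : IsTestField fun x ↦ a⁻¹ • Y x :=
    ⟨hY.const_smul _, hc.mono fun x hx h0 ↦ hx (by simp [h0]), fun x ↦ by
      rw [norm_smul, norm_inv, Real.norm_of_nonneg ha.le, inv_mul_le_one₀ ha]
      exact hYa x⟩
  have h := (ENNReal.ofReal_le_iff_le_toReal hG).1 (ofReal_setIntegral_divergence_le G ht)
  have hd : Differentiable ℝ Y := hY.differentiable one_ne_zero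
  simp_rw [fun x ↦ divergence_const_smul a⁻¹ (hd x)] at h
  rwa [integral_const_mul, inv_mul_le_iff₀ ha] at h

lemma perimeter_empty : perimeter (∅ : Set (EuclideanSpace ℝ (Fin n))) = 0 := by
  simp [perimeter]

/-- A test field has total divergence zero, so its integral over the complement is that of the
opposite field over the set. -/
lemma perimeter_compl {G : Set (EuclideanSpace ℝ (Fin n))} (hG : NullMeasurableSet G) :
    perimeter Gᶜ = perimeter G := by
  have key : ∀ {H : Set (EuclideanSpace ℝ (Fin n))}, NullMeasurableSet H →
      perimeter Hᶜ ≤ perimeter H := by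
    intro H hH
    refine iSup₂_le fun X hX ↦ ?_
    have h := integral_add_compl₀ hH (integrable_divergence hX.contDiff hX.hasCompactSupport)
    rw [integral_divergence_eq_zero hX.contDiff hX.hasCompactSupport] at h
    refine le_trans (le_of_eq ?_) (ofReal_setIntegral_divergence_le H hX.neg)
    simp_rw [divergence_neg, integral_neg]
    congr 1
    linarith
  refine (key hG).antisymm ?_
  simpa using key hG.compl

/-! ### The cost of removing or adding balls. -/

/-- A radial `C¹` cutoff between two concentric balls whose gradient points inwards. -/
lemma exists_radial_cutoff (c : EuclideanSpace ℝ (Fin n)) {s r : ℝ} (hs : 0 < s) (hsr : s < r) :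
    ∃ η : EuclideanSpace ℝ (Fin n) → ℝ, ContDiff ℝ 1 η ∧ (∀ x, 0 ≤ η x) ∧ (∀ x, η x ≤ 1) ∧
      (∀ x, ‖x - c‖ ≤ s → η x = 1) ∧ (∀ x, r ≤ ‖x - c‖ → η x = 0) ∧
      ∀ x v, ‖v‖ ≤ 1 → fderiv ℝ η x v + fderiv ℝ η x (s⁻¹ • (x - c)) ≤ 0 := by
  have hD : 0 < r ^ 2 - s ^ 2 := by nlinarith
  set T := Real.smoothTransition with hT
  have hTd : ContDiff ℝ 1 T := Real.smoothTransition.contDiff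
  set u : EuclideanSpace ℝ (Fin n) → ℝ := fun x ↦ (r ^ 2 - ‖x - c‖ ^ 2) / (r ^ 2 - s ^ 2) with hu
  have hud : ContDiff ℝ 1 u := by
    refine (contDiff_const.sub ?_).div_const _
    exact (contDiff_id.sub contDiff_const).norm_sq ℝ
  have hone : ∀ x, ‖x - c‖ ≤ s → T (u x) = 1 := fun x hx ↦ by
    refine Real.smoothTransition.one_of_one_le ((one_le_div hD).2 ?_)
    nlinarith [norm_nonneg (x - c)]
  refine ⟨fun x ↦ T (u x), hTd.comp hud, fun x ↦ Real.smoothTransition.nonneg _,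
    fun x ↦ Real.smoothTransition.le_one _, hone, fun x hx ↦ ?_, fun x v hv ↦ ?_⟩
  · refine Real.smoothTransition.zero_of_nonpos (div_nonpos_of_nonpos_of_nonneg ?_ hD.le)
    nlinarith [norm_nonneg (x - c)]
  · rcases lt_or_ge ‖x - c‖ s with h | h
    · have : (fun y ↦ T (u y)) =ᶠ[𝓝 x] fun _ ↦ 1 := by
        have : ∀ᶠ y in 𝓝 x, ‖y - c‖ < s :=
          (by fun_prop : Continuous fun y : EuclideanSpace ℝ (Fin n) ↦ ‖y - c‖).continuousAt.eventually_lt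
            continuousAt_const h
        filter_upwards [this] with y hy using hone y hy.le
      rw [this.fderiv_eq]
      simp
    · have hux : HasFDerivAt u ((r ^ 2 - s ^ 2)⁻¹ • -((2 : ℕ) • innerSL ℝ (x - c))) x := by
        have h1 : HasFDerivAt (fun y : EuclideanSpace ℝ (Fin n) ↦ ‖y - c‖ ^ 2)
            ((2 : ℕ) • innerSL ℝ (x - c)) x := by
          have := ((hasFDerivAt_id x).sub_const c).norm_sq
          simpa using this
        have h2 := (h1.const_sub (r ^ 2)).const_smul (r ^ 2 - s ^ 2)⁻¹
        refine h2.congr_of_eventuallyEq (Eventually.of_forall fun y ↦ ?_)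
        simp [hu, div_eq_inv_mul]
      have hTx : HasDerivAt T (deriv T (u x)) (u x) :=
        ((hTd.differentiable one_ne_zero) _).hasDerivAt
      have hder : HasFDerivAt (fun y ↦ T (u y)) _ x := hTx.comp_hasFDerivAt x hux
      have hT0 : 0 ≤ deriv T (u x) := Real.smoothTransition.monotone.deriv_nonneg
      rw [hder.fderiv, ← map_add]
      -- Outside the ball of radius s, the vector (x - c)/s has length at least 1, so its radial
      -- component outweighs that of any v in the unit ball.
      have hin : 0 ≤ inner ℝ (x - c) (v + s⁻¹ • (x - c)) := by
        rw [inner_add_right, inner_smul_right, real_inner_self_eq_norm_sq]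
        have h1 := neg_le_of_abs_le (abs_real_inner_le_norm (x - c) v)
        have h2 : ‖x - c‖ ≤ s⁻¹ * ‖x - c‖ ^ 2 := by
          rw [le_inv_mul_iff₀ hs]
          nlinarith
        nlinarith [norm_nonneg (x - c)]
      have : 0 ≤ deriv T (u x) * ((r ^ 2 - s ^ 2)⁻¹ * (2 * inner ℝ (x - c) (v + s⁻¹ • (x - c)))) := by
        positivity
      simp only [smul_apply, neg_apply, smul_eq_mul, innerSL_apply_apply, nsmul_eq_mul]
      push_cast
      linarith

/-- The estimate behind `perimeter_diff_ball_le`, with a cutoff in place of the ball. -/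
lemma exists_cutoff_setIntegral_le {G : Set (EuclideanSpace ℝ (Fin n))}
    (hG : perimeter G ≠ ⊤) (c : EuclideanSpace ℝ (Fin n)) {s r : ℝ}
    (hs : 0 < s) (hsr : s < r) {X : EuclideanSpace ℝ (Fin n) → EuclideanSpace ℝ (Fin n)}
    (hX : IsTestField X) :
    ∃ η : EuclideanSpace ℝ (Fin n) → ℝ, Continuous η ∧ (∀ x, 0 ≤ η x) ∧ (∀ x, η x ≤ 1) ∧
      (∀ x, ‖x - c‖ ≤ s → η x = 1) ∧ (∀ x, r ≤ ‖x - c‖ → η x = 0) ∧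
      ∫ x in G, (1 - η x) * divergence X x ≤
        r / s * (perimeter G).toReal + n / s * volume.real (G ∩ ball c r) := by
  obtain ⟨η, hη, h0, h1, hone, hzero, hgrad⟩ := exists_radial_cutoff c hs hsr
  refine ⟨η, hη.continuous, h0, h1, hone, hzero, ?_⟩
  have hr : 0 < r := hs.trans hsr
  have hηd : Differentiable ℝ η := hη.differentiable one_ne_zero
  have hXd : Differentiable ℝ X := hX.contDiff.differentiable one_ne_zero
  have hηc : HasCompactSupport η := HasCompactSupport.intro (isCompact_closedBall c r)
    fun x hx ↦ hzero x (by simpa [dist_eq_norm] using (not_le.1 hx).le)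
  -- The calibrating field, of divergence -n/s. In the interpolation `Y` the terms with the gradient
  -- of η have a favourable sign. The norm bound r/s exceeds 1, but tends to 1 as s → r.
  set V : EuclideanSpace ℝ (Fin n) → EuclideanSpace ℝ (Fin n) := fun x ↦ (-s⁻¹) • (x - c) with hV
  have hVd : ContDiff ℝ 1 V := (contDiff_id.sub contDiff_const).const_smul _
  set Y : EuclideanSpace ℝ (Fin n) → EuclideanSpace ℝ (Fin n) :=
    fun x ↦ (1 - η x) • X x + η x • V x with hY
  have hYd : ContDiff ℝ 1 Y :=
    ((contDiff_const.sub hη).smul hX.contDiff).add (hη.smul hVd)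
  have hYc : HasCompactSupport Y := by
    refine HasCompactSupport.add ?_ ?_
    · exact hX.hasCompactSupport.mono fun x hx h0 ↦ hx (by simp [h0])
    · exact hηc.mono fun x hx h0 ↦ hx (by simp [h0])
  have hdiv (x) : divergence Y x = (1 - η x) * divergence X x - fderiv ℝ η x (X x)
      - n / s * η x - fderiv ℝ η x (s⁻¹ • (x - c)) := by
    have hVx : DifferentiableAt ℝ V x := hVd.differentiable one_ne_zero x
    rw [hY, divergence_add (by fun_prop) (by fun_prop), divergence_smul (by fun_prop) (hXd x),
      divergence_smul (hηd x) hVx, hV,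
      divergence_const_smul _ (by fun_prop), divergence_sub_const, fderiv_const_sub]
    simp only [neg_apply, neg_smul, map_neg]
    ring
  have hpt (x) : (1 - η x) * divergence X x ≤ divergence Y x + n / s * η x := by
    rw [hdiv]
    linarith [hgrad x (X x) (hX.norm_le_one x)]
  have hYn (x) : ‖Y x‖ ≤ r / s := by
    have hrs : 1 ≤ r / s := (one_le_div hs).2 hsr.le
    rcases lt_or_ge ‖x - c‖ r with h | h
    · have hVn : ‖V x‖ ≤ r / s := by
        rw [hV, norm_smul, norm_neg, norm_inv, Real.norm_of_nonneg hs.le, div_eq_inv_mul]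
        gcongr
      calc ‖Y x‖ ≤ ‖(1 - η x) • X x‖ + ‖η x • V x‖ := norm_add_le _ _
        _ = (1 - η x) * ‖X x‖ + η x * ‖V x‖ := by
          rw [norm_smul, norm_smul, Real.norm_of_nonneg (h0 x),
            Real.norm_of_nonneg (sub_nonneg.2 (h1 x))]
        _ ≤ (1 - η x) * (r / s) + η x * (r / s) := by
          have := h0 x
          have := sub_nonneg.2 (h1 x)
          have := (hX.norm_le_one x).trans hrs
          gcongr
        _ = r / s := by ring
    · simpa [hY, hzero x h] using (hX.norm_le_one x).trans hrs
  have hηi : Integrable η := hη.continuous.integrable_of_hasCompactSupport hηc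
  have hYi := integrable_divergence hYd hYc
  have hXi : Integrable fun x ↦ (1 - η x) * divergence X x :=
    (((continuous_const.sub hη.continuous).mul
      (continuous_divergence hX.contDiff)).integrable_of_hasCompactSupport
      ((hasCompactSupport_divergence hX.hasCompactSupport).mul_left))
  have hηG : ∫ x in G, η x ≤ volume.real (G ∩ ball c r) := by
    have hle : ∀ x, η x ≤ (ball c r).indicator (fun _ ↦ (1 : ℝ)) x := fun x ↦ by
      by_cases hx : x ∈ ball c r
      · simpa [hx] using h1 x
      · simpa [hx] using (hzero x (by simpa [dist_eq_norm] using hx)).le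
    have hi : Integrable ((ball c r).indicator fun _ ↦ (1 : ℝ)) :=
      (integrable_indicator_iff measurableSet_ball).2
        (integrableOn_const measure_ball_lt_top.ne)
    calc ∫ x in G, η x ≤ ∫ x in G, (ball c r).indicator (fun _ ↦ (1 : ℝ)) x :=
          integral_mono hηi.integrableOn hi.integrableOn hle
      _ = volume.real (G ∩ ball c r) := by
          rw [integral_indicator measurableSet_ball, Measure.restrict_restrict measurableSet_ball,
            inter_comm]
          simp
  calc ∫ x in G, (1 - η x) * divergence X x
      ≤ ∫ x in G, (divergence Y x + n / s * η x) :=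
        integral_mono hXi.integrableOn (hYi.integrableOn.add (hηi.integrableOn.const_mul _)) hpt
    _ = (∫ x in G, divergence Y x) + n / s * ∫ x in G, η x := by
        rw [integral_add hYi.integrableOn (hηi.integrableOn.const_mul _), integral_const_mul]
    _ ≤ _ := by
        gcongr
        exact setIntegral_divergence_le_mul hG hYd hYc (by positivity) hYn

/-- Removing a ball of radius `r` costs at most `n / r` times the removed volume. -/
lemma perimeter_diff_ball_le (G : Set (EuclideanSpace ℝ (Fin n)))
    (c : EuclideanSpace ℝ (Fin n)) {r : ℝ} (hr : 0 < r) :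
    perimeter (G \ ball c r) ≤
      perimeter G + ENNReal.ofReal (n / r) * volume (G ∩ ball c r) := by
  rcases eq_or_ne (perimeter G) ⊤ with hP | hP
  · simp [hP]
  have hfin : volume (G ∩ ball c r) ≠ ⊤ :=
    ((measure_mono inter_subset_right).trans_lt measure_ball_lt_top).ne
  refine iSup₂_le fun X hX ↦ ?_
  -- The shift by 2 makes s positive already at k = 0.
  set s : ℕ → ℝ := fun k ↦ r - r / (k + 2) with hs
  have hslim : Tendsto s atTop (𝓝 r) := by
    have h1 : Tendsto (fun k : ℕ ↦ r / ((k : ℝ) + 2)) atTop (𝓝 0) :=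
      tendsto_const_nhds.div_atTop
        (tendsto_atTop_add_const_right _ _ tendsto_natCast_atTop_atTop)
    simpa [hs] using tendsto_const_nhds (x := r).sub h1
  have hs0 (k) : 0 < s k := by
    have : r / ((k : ℝ) + 2) < r := div_lt_self hr (by linarith [k.cast_nonneg (α := ℝ)])
    simp only [hs]; linarith
  have hsr (k) : s k < r := by
    have : 0 < r / ((k : ℝ) + 2) := by positivity
    simp only [hs]; linarith
  choose η hηc h0 h1 hone hzero hle using fun k ↦
    exists_cutoff_setIntegral_le hP c (hs0 k) (hsr k) hX
  have hXi := integrable_divergence hX.contDiff hX.hasCompactSupport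
  have hlim : Tendsto (fun k ↦ ∫ x in G, (1 - η k x) * divergence X x) atTop
      (𝓝 (∫ x in G, (ball c r)ᶜ.indicator (divergence X) x)) := by
    refine tendsto_integral_of_dominated_convergence (fun x ↦ ‖divergence X x‖)
      (fun k ↦ ((continuous_const.sub (hηc k)).mul
        (continuous_divergence hX.contDiff)).aestronglyMeasurable)
      hXi.norm.integrableOn (fun k ↦ Eventually.of_forall fun x ↦ ?_)
      (Eventually.of_forall fun x ↦ ?_)
    · rw [norm_mul]
      refine mul_le_of_le_one_left (norm_nonneg _) ?_
      rw [Real.norm_of_nonneg (sub_nonneg.2 (h1 k x))]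
      linarith [h0 k x]
    · refine tendsto_const_nhds.congr' ?_
      by_cases hx : x ∈ ball c r
      · have : ∀ᶠ k in atTop, ‖x - c‖ < s k :=
          hslim.eventually (lt_mem_nhds (by simpa [dist_eq_norm] using hx))
        filter_upwards [this] with k hk
        simp [hx, hone k x hk.le]
      · refine Eventually.of_forall fun k ↦ ?_
        simp [hx, hzero k x (by simpa [dist_eq_norm] using hx)]
  have hrhs : Tendsto (fun k ↦ r / s k * (perimeter G).toReal
      + n / s k * volume.real (G ∩ ball c r)) atTop
      (𝓝 (r / r * (perimeter G).toReal + n / r * volume.real (G ∩ ball c r))) :=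
    ((tendsto_const_nhds.div hslim hr.ne').mul_const _).add
      ((tendsto_const_nhds.div hslim hr.ne').mul_const _)
  have h := le_of_tendsto_of_tendsto' hlim hrhs hle
  rw [div_self hr.ne', one_mul, integral_indicator measurableSet_ball.compl,
    Measure.restrict_restrict measurableSet_ball.compl, inter_comm, ← sdiff_eq] at h
  calc ENNReal.ofReal (∫ x in G \ ball c r, divergence X x)
      ≤ ENNReal.ofReal ((perimeter G).toReal + n / r * volume.real (G ∩ ball c r)) :=
        ENNReal.ofReal_le_ofReal h
    _ = _ := by
        rw [ENNReal.ofReal_add (by positivity) (by positivity), ENNReal.ofReal_toReal hP,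
          ENNReal.ofReal_mul (by positivity), Measure.real, ENNReal.ofReal_toReal hfin]

/-- Each ball is removed from what the previous ones have left, so overlaps are paid for only once.
-/
lemma perimeter_diff_finite_iUnion_ball_le {G : Set (EuclideanSpace ℝ (Fin n))}
    (c : ℕ → EuclideanSpace ℝ (Fin n)) {r : ℝ} (hr : 0 < r) (k : ℕ) :
    perimeter (G \ ⋃ i < k, ball (c i) r) ≤
      perimeter G + ENNReal.ofReal (n / r) * volume (G ∩ ⋃ i < k, ball (c i) r) := by
  induction k with
  | zero => simp
  | succ k ih =>
    set U := ⋃ i < k, ball (c i) r with hU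
    have hsucc : ⋃ i < k + 1, ball (c i) r = U ∪ ball (c k) r := biUnion_lt_succ _ _
    have hUm : MeasurableSet U := .iUnion fun _ ↦ .iUnion fun _ ↦ measurableSet_ball
    have hvol : volume (G ∩ U) + volume ((G \ U) ∩ ball (c k) r) =
        volume (G ∩ (U ∪ ball (c k) r)) := by
      rw [← measure_inter_add_sdiff (G ∩ (U ∪ ball (c k) r)) hUm]
      congr 2 <;> ext x <;> simp only [mem_inter_iff, mem_union, Set.mem_sdiff] <;> tauto
    rw [hsucc, ← Set.sdiff_sdiff, ← hvol, mul_add, ← add_assoc]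
    refine (perimeter_diff_ball_le _ (c k) hr).trans ?_
    gcongr

/-- Removing a union of balls of radius `r` costs at most `n / r` times the removed volume. -/
lemma perimeter_diff_thickening_le (G : Set (EuclideanSpace ℝ (Fin n)))
    (M : Set (EuclideanSpace ℝ (Fin n))) {r : ℝ} (hr : 0 < r) :
    perimeter (G \ thickening r M) ≤
      perimeter G + ENNReal.ofReal (n / r) * volume (G ∩ thickening r M) := by
  -- By Lindelöf countably many balls suffice; the bound for finite unions then passes to the limit
  -- for each fixed test field.
  obtain ⟨T, hTM, hTc, hTU⟩ := TopologicalSpace.isOpen_biUnion_countable M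
    (fun c ↦ ball c r) (fun _ _ ↦ isOpen_ball)
  rw [thickening_eq_biUnion_ball, ← hTU]
  rcases T.eq_empty_or_nonempty with rfl | hTne
  · simp
  obtain ⟨c, rfl⟩ := hTc.exists_eq_range hTne
  rw [biUnion_range]
  refine iSup₂_le fun X hX ↦ ?_
  have hXi := integrable_divergence hX.contDiff hX.hasCompactSupport
  have hUm (k : ℕ) : MeasurableSet (⋃ i < k, ball (c i) r) :=
    .iUnion fun _ ↦ .iUnion fun _ ↦ measurableSet_ball
  have hrestrict {A : Set (EuclideanSpace ℝ (Fin n))} (hA : MeasurableSet A) :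
      ∫ x in G \ A, divergence X x = ∫ x in Aᶜ, divergence X x ∂(volume.restrict G) := by
    rw [Measure.restrict_restrict hA.compl, inter_comm, ← sdiff_eq]
  have hset : (⋃ i, ball (c i) r)ᶜ = ⋂ k, (⋃ i < k, ball (c i) r)ᶜ := by
    ext x
    simp only [mem_compl_iff, mem_iUnion, mem_iInter, not_exists]
    exact ⟨fun h k i _ ↦ h i, fun h i ↦ h (i + 1) i i.lt_succ_self⟩
  have hlim := tendsto_setIntegral_of_antitone (μ := volume.restrict G) (f := divergence X)
    (fun k ↦ (hUm k).compl)
    (fun k l hkl ↦ compl_subset_compl.2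
      (biUnion_subset_biUnion_left fun i hi ↦ lt_of_lt_of_le hi hkl))
    ⟨0, hXi.integrableOn.integrableOn⟩
  simp_rw [← hset, ← hrestrict (hUm _)] at hlim
  rw [← hrestrict (.iUnion fun _ ↦ measurableSet_ball)] at hlim
  refine le_of_tendsto' ((ENNReal.continuous_ofReal.tendsto _).comp hlim) fun k ↦ ?_
  refine (ofReal_setIntegral_divergence_le _ hX).trans
    ((perimeter_diff_finite_iUnion_ball_le c hr k).trans ?_)
  gcongr
  exact iUnion_subset fun _ ↦ Subset.rfl

/-- Adding a union of balls of radius `r` costs at most `n / r` times the added volume. -/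
lemma perimeter_union_thickening_le {G : Set (EuclideanSpace ℝ (Fin n))} (hG : NullMeasurableSet G)
    (M : Set (EuclideanSpace ℝ (Fin n))) {r : ℝ} (hr : 0 < r) :
    perimeter (G ∪ thickening r M) ≤
      perimeter G + ENNReal.ofReal (n / r) * volume (thickening r M \ G) := by
  have hm : MeasurableSet (thickening r M) := isOpen_thickening.measurableSet
  have h := perimeter_diff_thickening_le Gᶜ M hr
  rw [perimeter_compl hG, sdiff_eq, ← compl_union, perimeter_compl (hG.union hm.nullMeasurableSet),
    inter_comm, ← sdiff_eq] at h
  exact h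

/-! ### Continuity of the volume of thickenings. -/

/-- The level sets of a distance function at positive heights are Lebesgue null. -/
lemma volume_infDist_eq (M : Set (EuclideanSpace ℝ (Fin n))) {ρ : ℝ} (hρ : 0 < ρ) :
    volume {x | infDist x M = ρ} = 0 := by
  set L := {x | infDist x M = ρ} with hL
  have hLm : MeasurableSet L := (isClosed_eq (continuous_infDist_pt M) continuous_const).measurableSet
  -- At a point x of L, the ball of radius r/2 centred r/2 away from x towards a nearest point of
  -- `closure M` misses L. The density of L at x is thus at most 1 - 2⁻ⁿ, against Lebesgue's density
  -- theorem.
  have hdens := Besicovitch.ae_tendsto_measure_inter_div (volume) L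
  suffices h : ∀ᵐ x ∂(volume.restrict L), False by
    have h0 : volume.restrict L = 0 := by simpa using h
    exact Measure.restrict_eq_zero.1 h0
  filter_upwards [hdens, ae_restrict_mem hLm] with x hx hxL
  have hxM : infDist x (closure M) = ρ := by rw [infDist_closure]; exact hxL
  have hne : M.Nonempty := by
    rw [nonempty_iff_ne_empty]
    rintro rfl
    simp [hL] at hxL
    linarith
  obtain ⟨c, hc, hcx⟩ := isClosed_closure.exists_infDist_eq_dist hne.closure x
  have hcρ : ‖c - x‖ = ρ := by rw [← dist_eq_norm, dist_comm, ← hcx, hxM]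
  set a : ENNReal := ENNReal.ofReal ((1 / 2) ^ Module.finrank ℝ (EuclideanSpace ℝ (Fin n)))
    with ha
  have hbound : ∀ᶠ r in 𝓝[>] (0 : ℝ),
      volume (L ∩ closedBall x r) / volume (closedBall x r) + a ≤ 1 := by
    filter_upwards [Ioo_mem_nhdsGT hρ] with r hr
    obtain ⟨hr0, hrρ⟩ := hr
    set t : ℝ := r / 2 / ρ with ht
    have ht0 : 0 ≤ t := by positivity
    have ht1 : t ≤ 1 := by rw [ht, div_le_one hρ]; linarith
    set y := x + t • (c - x) with hy
    have hyx : dist y x = r / 2 := by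
      rw [dist_eq_norm, hy, add_sub_cancel_left, norm_smul, hcρ, Real.norm_of_nonneg ht0, ht]
      field_simp
    have hyc : dist y c = ρ - r / 2 := by
      have : y - c = (t - 1) • (c - x) := by rw [hy]; module
      rw [dist_eq_norm, this, norm_smul, hcρ, Real.norm_of_nonpos (by linarith), ht]
      field_simp
      ring
    have hsub : ball y (r / 2) ⊆ closedBall x r := fun z hz ↦ by
      rw [mem_ball] at hz
      rw [mem_closedBall]
      linarith [dist_triangle z y x]
    have hdisj : Disjoint (L ∩ closedBall x r) (ball y (r / 2)) := by
      rw [Set.disjoint_left]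
      rintro z ⟨hzL, -⟩ hz
      rw [mem_ball] at hz
      have h1 : infDist z (closure M) ≤ dist z c := infDist_le_dist_of_mem hc
      rw [infDist_closure, hzL] at h1
      linarith [dist_triangle z y c]
    have hB0 : volume (closedBall x r) ≠ 0 := (measure_closedBall_pos _ _ hr0).ne'
    have hBt : volume (closedBall x r) ≠ ⊤ := measure_closedBall_lt_top.ne
    have hball : volume (ball y (r / 2)) = a * volume (closedBall x r) := by
      rw [Measure.addHaar_ball_of_pos volume y (by positivity), Measure.addHaar_closedBall _ _ hr0.le,
        ← mul_assoc, ha, ← ENNReal.ofReal_mul (by positivity), ← mul_pow]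
      ring_nf
    have hsum : volume (L ∩ closedBall x r) + a * volume (closedBall x r)
        ≤ volume (closedBall x r) := by
      rw [← hball, ← measure_union hdisj measurableSet_ball]
      exact measure_mono (union_subset inter_subset_right hsub)
    calc volume (L ∩ closedBall x r) / volume (closedBall x r) + a
        = (volume (L ∩ closedBall x r) + a * volume (closedBall x r))
            / volume (closedBall x r) := by
          rw [ENNReal.add_div, ENNReal.mul_div_cancel_right hB0 hBt]
      _ ≤ volume (closedBall x r) / volume (closedBall x r) := by gcongr
      _ = 1 := ENNReal.div_self hB0 hBt
  have hle := le_of_tendsto (hx.add_const a) hbound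
  have ha0 : a ≠ 0 := by simp [ha]
  exact absurd hle (not_le.2 (ENNReal.lt_add_right ENNReal.one_ne_top ha0))

/-- Intermediate values of `t ↦ |S ∩ thickening t M|`. -/
lemma exists_volume_inter_thickening_eq {M S : Set (EuclideanSpace ℝ (Fin n))} (hM : M.Nonempty)
    (hS : volume S ≠ ⊤) {a b : ℝ} (ha : 0 < a) (hab : a ≤ b) {v : ENNReal}
    (hva : volume (S ∩ thickening a M) ≤ v) (hvb : v ≤ volume (S ∩ thickening b M)) :
    ∃ t ∈ Icc a b, volume (S ∩ thickening t M) = v := by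
  have hm (t : ℝ) : MeasurableSet (thickening t M) := isOpen_thickening.measurableSet
  have : IsFiniteMeasure (volume.restrict S) := ⟨by simpa using hS.lt_top⟩
  have hres (t : ℝ) : volume.restrict S (thickening t M) = volume (S ∩ thickening t M) := by
    rw [Measure.restrict_apply (hm t), inter_comm]
  simp_rw [← hres] at hva hvb ⊢
  refine intermediate_value_Icc hab (fun t ht ↦ ContinuousAt.continuousWithinAt ?_) ⟨hva, hvb⟩
  refine tendsto_measure_of_ae_tendsto_indicator_of_isFiniteMeasure _ (hm t) hm ?_
  have hnull : ∀ᵐ x ∂(volume.restrict S), infDist x M ≠ t :=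
    ae_restrict_of_ae (measure_eq_zero_iff_ae_notMem.1 (volume_infDist_eq M (ha.trans_le ht.1)))
  filter_upwards [hnull] with x hx
  rcases hx.lt_or_gt with h | h
  · filter_upwards [lt_mem_nhds h] with s hs
    exact iff_of_true ((mem_thickening_iff_infDist_lt hM).2 hs)
      ((mem_thickening_iff_infDist_lt hM).2 h)
  · filter_upwards [gt_mem_nhds h] with s hs
    exact iff_of_false (fun h' ↦ hs.not_gt ((mem_thickening_iff_infDist_lt hM).1 h'))
      fun h' ↦ h.not_gt ((mem_thickening_iff_infDist_lt hM).1 h')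

/-! ### Geometry of the uniform ball condition. -/

/-- A preconnected set that meets both `A` and its complement meets the frontier of `A`. -/
lemma exists_mem_frontier_of_isPreconnected {α : Type*} [TopologicalSpace α] {S A : Set α}
    (hS : IsPreconnected S) {x y : α} (hx : x ∈ S) (hxA : x ∈ A) (hy : y ∈ S) (hyA : y ∉ A) :
    ∃ p ∈ S, p ∈ frontier A := by
  by_contra! h
  have hcover : S ⊆ interior A ∪ interior Aᶜ := fun p hp ↦ by
    by_contra hn
    refine h p hp ?_
    rw [mem_union, not_or, interior_compl, mem_compl_iff, not_not] at hn
    exact ⟨hn.2, hn.1⟩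
  have hxi : x ∈ interior A := (hcover hx).resolve_right fun h ↦ interior_subset h hxA
  have hsub := hS.subset_left_of_subset_union isOpen_interior isOpen_interior
    (disjoint_compl_right.mono interior_subset interior_subset) hcover ⟨x, hx, hxi⟩
  exact hyA (interior_subset (hsub hy))

lemma ball_subset_of_disjoint_frontier {A : Set (EuclideanSpace ℝ (Fin n))}
    {x : EuclideanSpace ℝ (Fin n)} {r : ℝ} (hx : x ∈ A) (h : Disjoint (ball x r) (frontier A)) :
    ball x r ⊆ A := fun y hy ↦ by
  by_contra hyA
  obtain ⟨p, hp, hpA⟩ := exists_mem_frontier_of_isPreconnected (convex_ball x r).isPreconnected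
    (mem_ball_self (pos_of_mem_ball hy)) hx hy hyA
  exact Set.disjoint_left.1 h hp hpA

/-- The centres of the balls of radius `r` contained in `E`. -/
def ballCenters (E : Set (EuclideanSpace ℝ (Fin n))) (r : ℝ) :
    Set (EuclideanSpace ℝ (Fin n)) :=
  {c | ball c r ⊆ E}

lemma UniformBallCondition.compl {E : Set (EuclideanSpace ℝ (Fin n))} {r : ℝ}
    (hE : UniformBallCondition E r) : UniformBallCondition Eᶜ r := fun x hx ↦ by
  obtain ⟨xp, xm, h1, h2, h3, h4⟩ := hE x (by rwa [frontier_compl] at hx)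
  exact ⟨xm, xp, by rwa [compl_compl], h1, h4, h3⟩

lemma closedTube_compl (E : Set (EuclideanSpace ℝ (Fin n))) (δ : ℝ) :
    closedTube Eᶜ δ = closedTube E δ := by
  rw [closedTube, closedTube, frontier_compl]

lemma mem_closedTube_iff {E : Set (EuclideanSpace ℝ (Fin n))} {δ : ℝ} (hδ : 0 < δ)
    {x : EuclideanSpace ℝ (Fin n)} :
    x ∈ closedTube E δ ↔ ∃ p ∈ frontier E, dist x p ≤ δ := by
  rw [closedTube, closure_thickening hδ, isClosed_frontier.cthickening_eq_biUnion_closedBall hδ.le]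
  simp

lemma le_dist_of_mem_ballCenters {E : Set (EuclideanSpace ℝ (Fin n))} {r : ℝ}
    {c p : EuclideanSpace ℝ (Fin n)} (hc : c ∈ ballCenters E r) (hp : p ∈ frontier E) :
    r ≤ dist p c := by
  by_contra! h
  exact hp.2 (interior_maximal hc isOpen_ball h)

lemma thickening_ballCenters_subset {E : Set (EuclideanSpace ℝ (Fin n))} {r s : ℝ} (hs : s ≤ r) :
    thickening s (ballCenters E r) ⊆ E := fun x hx ↦ by
  obtain ⟨c, hc, hxc⟩ := mem_thickening_iff.1 hx
  exact hc (mem_ball.2 (hxc.trans_le hs))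

lemma disjoint_thickening_ballCenters_closedTube {E : Set (EuclideanSpace ℝ (Fin n))} {r δ : ℝ}
    (hδ : 0 < δ) : Disjoint (thickening (r - δ) (ballCenters E r)) (closedTube E δ) := by
  rw [Set.disjoint_left]
  intro x hx hxt
  obtain ⟨c, hc, hxc⟩ := mem_thickening_iff.1 hx
  obtain ⟨p, hp, hxp⟩ := (mem_closedTube_iff hδ).1 hxt
  linarith [le_dist_of_mem_ballCenters hc hp, dist_triangle p x c, dist_comm p x]

/-- The segment from a centre to a point outside E crosses the frontier at distance at least r from
the centre, so less than δ remains. -/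
lemma thickening_ballCenters_subset_union {E : Set (EuclideanSpace ℝ (Fin n))} {r δ : ℝ}
    (hr : 0 < r) (hδ : 0 < δ) :
    thickening (r + δ) (ballCenters E r) ⊆ E ∪ closedTube E δ := fun x hx ↦ by
  obtain ⟨c, hc, hxc⟩ := mem_thickening_iff.1 hx
  rw [mem_union, or_iff_not_imp_left]
  intro hxE
  obtain ⟨p, hp, hpE⟩ := exists_mem_frontier_of_isPreconnected
    (convex_segment c x).isPreconnected (left_mem_segment ℝ c x) (hc (mem_ball_self hr))
    (right_mem_segment ℝ c x) hxE
  refine (mem_closedTube_iff hδ).2 ⟨p, hpE, ?_⟩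
  have h := dist_add_dist_of_mem_segment hp
  linarith [le_dist_of_mem_ballCenters hc hpE, dist_comm c p, dist_comm x p, dist_comm c x]

lemma infDist_ballCenters_le_of_mem_closedTube {E : Set (EuclideanSpace ℝ (Fin n))} {r δ : ℝ}
    (hE : UniformBallCondition E r) (hδ : 0 < δ) {x : EuclideanSpace ℝ (Fin n)}
    (hx : x ∈ closedTube E δ) : infDist x (ballCenters E r) ≤ r + δ := by
  obtain ⟨p, hp, hxp⟩ := (mem_closedTube_iff hδ).1 hx
  obtain ⟨-, xm, -, hxm, -, hpm⟩ := hE p hp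
  have h : infDist x (ballCenters E r) ≤ dist x xm := infDist_le_dist_of_mem hxm
  rw [mem_sphere] at hpm
  linarith [dist_triangle x p xm]

/-- Under the uniform ball condition, the points of `E` off the tube of width `δ` are covered by
balls of radius `r - δ` concentric to balls of radius `r` in `E`. -/
lemma mem_thickening_ballCenters {E : Set (EuclideanSpace ℝ (Fin n))} {r δ : ℝ}
    (hE : UniformBallCondition E r) (hδ : 0 < δ) (hδr : δ < r) {x : EuclideanSpace ℝ (Fin n)}
    (hx : x ∈ E) (hxt : x ∉ closedTube E δ) : x ∈ thickening (r - δ) (ballCenters E r) := by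
  have hr : 0 < r := hδ.trans hδr
  rw [mem_thickening_iff]
  by_cases hdisj : Disjoint (ball x r) (frontier E)
  · exact ⟨x, ball_subset_of_disjoint_frontier hx hdisj, by simpa using hδr⟩
  obtain ⟨q, hq, hqE⟩ := Set.not_disjoint_iff.1 hdisj
  obtain ⟨p, hp, hxp⟩ := isClosed_frontier.exists_infDist_eq_dist ⟨q, hqE⟩ x
  set d := dist x p with hd
  have hmin (z) (hz : z ∈ frontier E) : d ≤ dist x z := hxp ▸ infDist_le_dist_of_mem hz
  have hdr : d < r := (hmin q hqE).trans_lt (by rwa [mem_ball, dist_comm] at hq)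
  have hδd : δ < d := by
    by_contra! h
    exact hxt ((mem_closedTube_iff hδ).2 ⟨p, hp, h⟩)
  have hd0 : 0 < d := hδ.trans hδd
  have hball : ball x d ⊆ E := ball_subset_of_disjoint_frontier hx <| by
    rw [Set.disjoint_left]
    intro z hz hzE
    rw [mem_ball, dist_comm] at hz
    exact (hmin z hzE).not_gt hz
  obtain ⟨xp, xm, hxpE, hxmE, hpp, hpm⟩ := hE p hp
  rw [mem_sphere] at hpp hpm
  -- A ball in E touching the exterior ball at p has its centre on the ray from `xp` through p, by
  -- equality in the triangle inequality. Both x and `xm` are such centres, so |x - xm| = r - d < r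
  -- - δ.
  have touch {y : EuclideanSpace ℝ (Fin n)} {s : ℝ} (hs : 0 < s) (hy : ball y s ⊆ E)
      (hyp : dist y p = s) : r • (y - p) = s • (p - xp) := by
    have h1 : s + r ≤ dist y xp := (disjoint_ball_ball_iff hs hr).1
      (disjoint_compl_right.mono hy hxpE)
    have h2 : ‖(y - p) + (p - xp)‖ = ‖y - p‖ + ‖p - xp‖ := by
      refine (norm_add_le _ _).antisymm ?_
      rw [← dist_eq_norm, ← dist_eq_norm, hyp, hpp, sub_add_sub_cancel, ← dist_eq_norm]
      exact h1
    have h3 := (sameRay_iff_norm_add.2 h2).norm_smul_eq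
    rw [← dist_eq_norm, ← dist_eq_norm, hyp, hpp] at h3
    exact h3.symm
  have t1 := touch hd0 hball rfl
  have t2 := touch hr hxmE (by rw [dist_comm, hpm])
  have t3 : xm - p = p - xp := smul_right_injective _ hr.ne' t2
  refine ⟨xm, hxmE, ?_⟩
  have h4 : r • (x - xm) = (d - r) • (p - xp) := by
    rw [sub_smul, ← t1, ← t3]
    module
  have h5 : r * dist x xm = (r - d) * r := by
    have := congrArg norm h4
    rw [norm_smul, norm_smul, Real.norm_of_nonneg hr.le, Real.norm_of_nonpos (by linarith),
      ← dist_eq_norm, ← dist_eq_norm, hpp] at this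
    linarith
  have h6 : dist x xm = r - d := by
    have : r * dist x xm = r * (r - d) := by linarith
    exact mul_left_cancel₀ hr.ne' this
  linarith

/-- Points of the tube are within r + δ of a centre by the interior touching ball; equality occurs
only on a null level set. The one-sided hypothesis on F lets the lemma serve Fᶜ and Eᶜ as well. -/
lemma ae_mem_thickening_ballCenters {E F : Set (EuclideanSpace ℝ (Fin n))} {r δ : ℝ}
    (hE : UniformBallCondition E r) (hδ : 0 < δ) (hδr : δ < r) (hne : (ballCenters E r).Nonempty)
    (hFE : ∀ x ∉ closedTube E δ, x ∈ F → x ∈ E) :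
    ∀ᵐ x, x ∈ F → x ∈ thickening (r + δ) (ballCenters E r) := by
  filter_upwards [measure_eq_zero_iff_ae_notMem.1
    (volume_infDist_eq (ballCenters E r) (by linarith : 0 < r + δ))] with x hx hxF
  rw [mem_thickening_iff_infDist_lt hne]
  refine lt_of_le_of_ne ?_ hx
  by_cases hxt : x ∈ closedTube E δ
  · exact infDist_ballCenters_le_of_mem_closedTube hE hδ hxt
  · have := (mem_thickening_iff_infDist_lt hne).1
      (mem_thickening_ballCenters hE hδ hδr (hFE x hxt hxF) hxt)
    linarith

lemma UniformBallCondition.ballCenters_nonempty {E : Set (EuclideanSpace ℝ (Fin n))} {r : ℝ}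
    (hE : UniformBallCondition E r) (hne : (frontier E).Nonempty) : (ballCenters E r).Nonempty := by
  obtain ⟨x, hx⟩ := hne
  obtain ⟨-, xm, -, h, -⟩ := hE x hx
  exact ⟨xm, h⟩

/-- All radii in the surgery are at least r - δ > r/2, so one constant serves them all. -/
lemma ofReal_natCast_div_le {r s : ℝ} (hr : 0 < r) (hs : r / 2 ≤ s) :
    ENNReal.ofReal (n / s) ≤ ENNReal.ofReal (2 * n / r) := by
  refine ENNReal.ofReal_le_ofReal ?_
  rw [div_le_div_iff₀ (by linarith) hr]
  nlinarith [n.cast_nonneg (α := ℝ)]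

/-! ### Construction of the competitor. -/

/-- Truncation to the tube: the boundary values of `E` off the tube are restored at a cost
proportional to the volume of the change. -/
lemma exists_truncation {E F G : Set (EuclideanSpace ℝ (Fin n))} {r δ : ℝ}
    (hE : UniformBallCondition E r) (hδ : 0 < δ) (hδr : δ < r / 4)
    (hFE : symmDiff F E ⊆ closedTube E δ) (hG : NullMeasurableSet G) :
    ∃ G₁ : Set (EuclideanSpace ℝ (Fin n)), NullMeasurableSet G₁ ∧
      thickening (r - δ) (ballCenters E r) ⊆ G₁ ∧
      Disjoint G₁ (thickening (r - δ) (ballCenters Eᶜ r)) ∧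
      (∀ x ∉ closedTube E δ, x ∈ G₁ ↔ x ∈ E) ∧ symmDiff F G₁ ⊆ symmDiff F G ∧
      perimeter G₁ ≤ perimeter G + 2 * (ENNReal.ofReal (2 * n / r) * volume (symmDiff F G)) := by
  have hr : 0 < r := by linarith
  have hrδ : 0 < r - δ := by linarith
  set Ki := thickening (r - δ) (ballCenters E r) with hKi
  set Ko := thickening (r - δ) (ballCenters Eᶜ r) with hKo
  have hKim : MeasurableSet Ki := isOpen_thickening.measurableSet
  have hKom : MeasurableSet Ko := isOpen_thickening.measurableSet
  have hKiE : Ki ⊆ E := thickening_ballCenters_subset (by linarith)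
  have hKoE : Ko ⊆ Eᶜ := thickening_ballCenters_subset (by linarith)
  have hKit : Disjoint Ki (closedTube E δ) := disjoint_thickening_ballCenters_closedTube hδ
  have hKot : Disjoint Ko (closedTube E δ) := by
    rw [← closedTube_compl]
    exact disjoint_thickening_ballCenters_closedTube hδ
  have hoff : ∀ x ∉ closedTube E δ, (x ∈ F ↔ x ∈ E) := fun x hx ↦ by
    have := fun h ↦ hx (hFE h)
    rw [mem_symmDiff] at this
    tauto
  have hKiF : Ki ⊆ F := fun x hx ↦ (hoff x (Set.disjoint_left.1 hKit hx)).2 (hKiE hx)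
  have hKoF : ∀ x ∈ Ko, x ∉ F := fun x hx h ↦
    hKoE hx ((hoff x (Set.disjoint_left.1 hKot hx)).1 h)
  have hKio : ∀ x ∈ Ki, x ∉ Ko := fun x hx h ↦ hKoE h (hKiE hx)
  have hGm : NullMeasurableSet (G \ Ko) := hG.diff hKom.nullMeasurableSet
  -- On `Ki` and `Ko`, which avoid the tube, F agrees with E; imposing these values only shrinks the
  -- difference from F. By the UBC the two sets cover everything off the tube.
  refine ⟨(G \ Ko) ∪ Ki, hGm.union hKim.nullMeasurableSet, subset_union_right, ?_, ?_, ?_, ?_⟩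
  · exact disjoint_union_left.2 ⟨disjoint_sdiff_left, Set.disjoint_left.2 hKio⟩
  · intro x hx
    constructor
    · rintro (⟨-, h⟩ | h)
      · by_contra hxE
        exact h (mem_thickening_ballCenters hE.compl hδ (by linarith) hxE
          (by rwa [closedTube_compl]))
      · exact hKiE h
    · exact fun hxE ↦ Or.inr (mem_thickening_ballCenters hE hδ (by linarith) hxE hx)
  · intro x hx
    have h1 := @hKiF x
    have h2 := hKoF x
    simp only [mem_symmDiff, mem_union, Set.mem_sdiff] at hx ⊢
    tauto
  · have h1 : perimeter (G \ Ko) ≤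
        perimeter G + ENNReal.ofReal (2 * n / r) * volume (symmDiff F G) := by
      refine (perimeter_diff_thickening_le G _ hrδ).trans (add_le_add le_rfl (mul_le_mul' ?_ ?_))
      · exact ofReal_natCast_div_le hr (by linarith)
      · exact measure_mono fun x hx ↦ Or.inr ⟨hx.1, hKoF x hx.2⟩
    refine (perimeter_union_thickening_le hGm _ hrδ).trans ?_
    rw [two_mul, ← add_assoc]
    gcongr ?_ + ?_ * ?_
    · exact ofReal_natCast_div_le hr (by linarith)
    · exact measure_mono fun x hx ↦ Or.inl ⟨hKiF hx.1, fun h ↦ hx.2 ⟨h, hKio x hx.1⟩⟩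

/-- Every set `G` can be turned into an admissible competitor of the constrained problem at a cost
proportional to its distance from `F`. -/
lemma exists_constrained_competitor {E F G : Set (EuclideanSpace ℝ (Fin n))} {r δ : ℝ}
    (hE : UniformBallCondition E r) (hEb : Bornology.IsBounded E) (hne : (frontier E).Nonempty)
    (hδ : 0 < δ) (hδr : δ < r / 4) (hFv : volume F ≠ ⊤)
    (hFE : symmDiff F E ⊆ closedTube E δ) (hG : HasFinitePerimeter G)
    (hm : volume (symmDiff F G) ≠ ⊤) :
    ∃ G' : Set (EuclideanSpace ℝ (Fin n)), HasFinitePerimeter G' ∧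
      symmDiff G' F ⊆ closedTube E δ ∧ volume G' = volume F ∧
      volume (symmDiff F G') ≤ 2 * volume (symmDiff F G) ∧
      perimeter G' ≤ perimeter G + 3 * (ENNReal.ofReal (2 * n / r) * volume (symmDiff F G)) := by
  have hr : 0 < r := by linarith
  obtain ⟨G₁, hG₁m, hKi, hKo, hoff₁, hsub, hper⟩ :=
    exists_truncation hE hδ hδr hFE hG.nullMeasurableSet
  set m := volume (symmDiff F G) with hmdef
  set κ := ENNReal.ofReal (2 * n / r) with hκ
  have hoff : ∀ x ∉ closedTube E δ, (x ∈ F ↔ x ∈ E) := fun x hx ↦ by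
    have := fun h ↦ hx (hFE h)
    rw [mem_symmDiff] at this
    tauto
  have hm₁ : volume (symmDiff F G₁) ≤ m := measure_mono hsub
  have hG₁v : volume G₁ ≠ ⊤ := by
    refine ne_top_of_le_ne_top (ENNReal.add_ne_top.2 ⟨hFv, hm⟩) (le_trans (measure_mono ?_)
      ((measure_union_le F (symmDiff F G₁)).trans (by gcongr)))
    intro x hx
    by_cases hxF : x ∈ F
    · exact Or.inl hxF
    · exact Or.inr (Or.inr ⟨hx, hxF⟩)
  suffices h : ∃ G' : Set (EuclideanSpace ℝ (Fin n)), NullMeasurableSet G' ∧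
      (∀ x ∉ closedTube E δ, x ∈ G' ↔ x ∈ E) ∧ volume G' = volume F ∧
      volume (symmDiff G₁ G') ≤ m ∧ perimeter G' ≤ perimeter G₁ + κ * m by
    obtain ⟨G', hm', hoff', hvol, hd, hp⟩ := h
    have hp' : perimeter G' ≤ perimeter G + 3 * (κ * m) := by
      refine hp.trans ((add_le_add_left hper _).trans (le_of_eq ?_))
      ring
    refine ⟨G', ⟨hm', hp'.trans_lt ?_⟩, ?_, hvol, ?_, hp'⟩
    · exact ENNReal.add_lt_top.2 ⟨hG.perimeter_lt_top, ENNReal.mul_lt_top (by simp)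
        (ENNReal.mul_lt_top ENNReal.ofReal_lt_top hm.lt_top)⟩
    · intro x hx
      by_contra hxt
      have h1 := hoff x hxt
      have h2 := hoff' x hxt
      rw [mem_symmDiff] at hx
      tauto
    · calc volume (symmDiff F G') ≤ volume (symmDiff F G₁) + volume (symmDiff G₁ G') :=
            (measure_mono (symmDiff_triangle F G₁ G')).trans (measure_union_le _ _)
        _ ≤ m + m := add_le_add hm₁ hd
        _ = 2 * m := (two_mul m).symm
  have hab : r - δ ≤ r + δ := by linarith
  have ha : 0 < r - δ := by linarith
  rcases le_total (volume G₁) (volume F) with hle | hle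
  -- Too little volume: add a thickening of the interior centres. At t = r - δ it adds nothing,
  -- since it lies in `G₁`; at t = r + δ it adds almost all of F \ G₁, which is at least the
  -- deficit.
  · set S := thickening (r + δ) (ballCenters E r) \ G₁ with hS
    have hSv : volume S ≠ ⊤ := by
      have hb : Bornology.IsBounded (ballCenters E r) :=
        hEb.subset fun c hc ↦ hc (mem_ball_self hr)
      exact ((measure_mono sdiff_subset).trans_lt (hb.thickening (δ := r + δ)).measure_lt_top).ne
    have hvm : volume F - volume G₁ ≤ volume (F \ G₁) := le_measure_sdiff
    obtain ⟨t, ⟨hta, htb⟩, htv⟩ := exists_volume_inter_thickening_eq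
      (v := volume F - volume G₁) (hE.ballCenters_nonempty hne) hSv ha hab
      (by
        have : S ∩ thickening (r - δ) (ballCenters E r) = ∅ :=
          eq_empty_of_forall_notMem fun x hx ↦ hx.1.2 (hKi hx.2)
        simp [this])
      (by
        refine hvm.trans (measure_mono_ae ?_)
        filter_upwards [ae_mem_thickening_ballCenters hE hδ (by linarith)
          (hE.ballCenters_nonempty hne) fun x hx ↦ (hoff x hx).1] with x hx hxF
        exact ⟨⟨hx hxF.1, hxF.2⟩, hx hxF.1⟩)
    set K := thickening t (ballCenters E r) with hK
    have hKm : MeasurableSet K := isOpen_thickening.measurableSet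
    have hKb : K ⊆ thickening (r + δ) (ballCenters E r) := thickening_mono htb _
    have hSK : S ∩ K = K \ G₁ := by
      ext x
      have := @hKb x
      simp only [hS, mem_inter_iff, Set.mem_sdiff]
      tauto
    rw [hSK] at htv
    have hKle : volume (K \ G₁) ≤ m := by
      rw [htv]
      exact hvm.trans ((measure_mono fun x hx ↦ Or.inl hx).trans hm₁)
    refine ⟨G₁ ∪ K, hG₁m.union hKm.nullMeasurableSet, fun x hx ↦ ?_, ?_, ?_, ?_⟩
    · rw [mem_union, hoff₁ x hx, or_iff_left_iff_imp]
      exact fun h ↦ (thickening_ballCenters_subset_union hr hδ (hKb h)).resolve_right hx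
    · rw [← union_sdiff_self, measure_union₀ (hKm.nullMeasurableSet.diff hG₁m)
        disjoint_sdiff_right.aedisjoint, htv, add_tsub_cancel_of_le hle]
    · refine le_trans (measure_mono fun x hx ↦ ?_) hKle
      simp only [mem_symmDiff, mem_union, Set.mem_sdiff] at hx ⊢
      tauto
    · refine (perimeter_union_thickening_le hG₁m _ (ha.trans_le hta)).trans ?_
      gcongr
      exact ofReal_natCast_div_le hr (by linarith)
  -- Too much volume: remove a thickening of the exterior centres. These may be unbounded, but the
  -- finite volume of `G₁` suffices for continuity in t.
  · have hvm : volume G₁ - volume F ≤ volume (G₁ \ F) := le_measure_sdiff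
    have hne' : (ballCenters Eᶜ r).Nonempty :=
      hE.compl.ballCenters_nonempty (by rwa [frontier_compl])
    obtain ⟨t, ⟨hta, htb⟩, htv⟩ := exists_volume_inter_thickening_eq
      (v := volume G₁ - volume F) hne' hG₁v ha hab
      (by simp [hKo.inter_eq])
      (by
        refine hvm.trans (measure_mono_ae ?_)
        filter_upwards [ae_mem_thickening_ballCenters (F := Fᶜ) hE.compl hδ (by linarith) hne'
          fun x hx h h' ↦ h ((hoff x (by rwa [closedTube_compl] at hx)).2 h')] with x hx hxF
        exact ⟨hxF.1, hx hxF.2⟩)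
    set K := thickening t (ballCenters Eᶜ r) with hK
    have hKm : MeasurableSet K := isOpen_thickening.measurableSet
    have hKle : volume (G₁ ∩ K) ≤ m := by
      rw [htv]
      exact hvm.trans ((measure_mono fun x hx ↦ Or.inr hx).trans hm₁)
    refine ⟨G₁ \ K, hG₁m.diff hKm.nullMeasurableSet, fun x hx ↦ ?_, ?_, ?_, ?_⟩
    · rw [Set.mem_sdiff, hoff₁ x hx, and_iff_left_iff_imp]
      intro hxE hxK
      have := thickening_ballCenters_subset_union hr hδ (thickening_mono htb _ hxK)
      rw [closedTube_compl] at this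
      exact this.elim (fun h ↦ h hxE) hx
    · have h := measure_inter_add_sdiff (μ := volume) G₁ hKm
      rw [htv] at h
      have h' := tsub_add_cancel_of_le hle
      have hfin : volume G₁ - volume F ≠ ⊤ := ENNReal.sub_ne_top hG₁v
      exact (ENNReal.add_right_inj hfin).1 (h.trans h'.symm)
    · refine le_trans (measure_mono fun x hx ↦ ?_) hKle
      simp only [mem_symmDiff, mem_inter_iff, Set.mem_sdiff] at hx ⊢
      tauto
    · refine (perimeter_diff_thickening_le G₁ _ (ha.trans_le hta)).trans ?_
      gcongr
      exact ofReal_natCast_div_le hr (by linarith)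

/-- The bound obtained by testing the constrained minimality with the competitor built from `G`. -/
lemma IsConstrainedMinimizer.perimeter_le {E F G : Set (EuclideanSpace ℝ (Fin n))} {r δ Λ α : ℝ}
    (hF : IsConstrainedMinimizer E δ Λ α F)
    (hE : UniformBallCondition E r) (hEb : Bornology.IsBounded E) (hne : (frontier E).Nonempty)
    (hδ : 0 < δ) (hδr : δ < r / 4) (hα : α ≤ 1) (hFv : volume F ≠ ⊤)
    (hFE : symmDiff F E ⊆ closedTube E δ) (hG : HasFinitePerimeter G)
    (hm : volume (symmDiff F G) ≠ ⊤) :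
    perimeter F ≤ perimeter G + (3 * (ENNReal.ofReal (2 * n / r) * volume (symmDiff F G)) +
      ENNReal.ofReal Λ * (2 * volume (symmDiff F G)) ^ (1 - α)) := by
  obtain ⟨G', hG', hsub, hvol, hd, hp⟩ := exists_constrained_competitor hE hEb hne hδ hδr
    hFv hFE hG hm
  refine (hF.le G' hG' hsub hvol).trans ?_
  rw [← add_assoc]
  gcongr

lemma hasFinitePerimeter_empty : HasFinitePerimeter (∅ : Set (EuclideanSpace ℝ (Fin n))) :=
  ⟨.empty, by simp [perimeter_empty]⟩

end AlmostMin

/-! ### The unconstrained inequality. -/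

open AlmostMin in
theorem lemma2p9 (n : ℕ) (hn : 1 ≤ n) (Λ r₀ R₀ : ℝ) (hΛ : 0 < Λ) (hr₀ : 0 < r₀) (hR₀ : 0 < R₀) :
    ∃ Λ₁ : ℝ, 0 ≤ Λ₁ ∧ ∀ (α δ : ℝ) (E F : Set (EuclideanSpace ℝ (Fin n))),
      AlmostMin.UniformBallCondition E r₀ →
      E ⊆ Metric.ball 0 R₀ →
      0 < δ → δ < r₀ / 4 →
      AlmostMin.IsConstrainedMinimizer E δ Λ α F →
      volume F = volume E →
      symmDiff F E ⊆ AlmostMin.closedTube E δ →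
      AlmostMin.IsMinimizer Λ₁ α F := by
  set V := volume (Metric.ball (0 : EuclideanSpace ℝ (Fin n)) R₀) with hV
  have hVt : V ≠ ⊤ := measure_ball_lt_top.ne
  set κ := ENNReal.ofReal (2 * n / r₀) with hκ
  set L := ENNReal.ofReal Λ with hL
  -- `C₁` serves m ≤ 1, where (2m)^(1-α) ≤ 2m^(1-α). `C₂` bounds P(F) and serves m ≥ 1; its term 1 +
  -- 2V dominates (2|F|)^(1-α) for all admissible α at once.
  set C₁ := 3 * κ + L * 2 with hC₁
  set C₂ := 3 * (κ * V) + L * (1 + 2 * V) with hC₂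
  have hC : C₁ + C₂ ≠ ⊤ := by finiteness
  refine ⟨(C₁ + C₂).toReal, ENNReal.toReal_nonneg, fun α δ E F hE hER hδ hδr hF hvol hFE ↦ ?_⟩
  refine ⟨ENNReal.toReal_nonneg, hF.nonneg_exp, hF.exp_lt, hF.finitePerimeter, fun G hG ↦ ?_⟩
  rw [ENNReal.ofReal_toReal hC]
  rcases (frontier E).eq_empty_or_nonempty with hemp | hne
  -- Without frontier there are no touching balls; but then the bounded set E is empty, hence so are
  -- the tube and F.
  · have hF0 : F = ∅ := by
      have : Nonempty (Fin n) := ⟨⟨0, hn⟩⟩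
      have hE0 : E = ∅ := by
        refine (frontier_eq_empty_iff.1 hemp).resolve_right ?_
        rintro rfl
        obtain ⟨x, hx⟩ := NormedSpace.exists_lt_norm ℝ (EuclideanSpace ℝ (Fin n)) R₀
        have := hER (Set.mem_univ x)
        rw [mem_ball_zero_iff] at this
        exact hx.not_gt this
      rw [closedTube, hemp, Metric.thickening_empty, closure_empty, Set.subset_empty_iff, hE0] at hFE
      exact symmDiff_eq_bot.1 hFE
    simp [hF0, perimeter_empty]
  have hEb : Bornology.IsBounded E := Metric.isBounded_ball.subset hER
  have hFV : volume F ≤ V := hvol.trans_le (measure_mono hER)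
  have hFt : volume F ≠ ⊤ := ne_top_of_le_ne_top hVt hFV
  have hα : α ≤ 1 := by
    refine hF.exp_lt.le.trans ?_
    rw [div_le_one (by positivity)]
    exact_mod_cast hn
  have hβ : 0 ≤ 1 - α := by linarith
  have hβ1 : 1 - α ≤ 1 := by linarith [hF.nonneg_exp]
  set m := volume (symmDiff F G) with hm
  rcases le_total m 1 with hm1 | hm1
  · have hmt : m ≠ ⊤ := ne_top_of_le_ne_top ENNReal.one_ne_top hm1
    refine (hF.perimeter_le hE hEb hne hδ hδr hα hFt hFE hG hmt).trans ?_
    gcongr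
    have h1 : m ≤ m ^ (1 - α) := by
      simpa using ENNReal.rpow_le_rpow_of_exponent_ge hm1 hβ1
    have h2 : (2 * m) ^ (1 - α) ≤ 2 * m ^ (1 - α) := by
      rw [ENNReal.mul_rpow_of_nonneg _ _ hβ]
      gcongr
      simpa using ENNReal.rpow_le_rpow_of_exponent_le (x := 2) (by norm_num) hβ1
    calc 3 * (κ * m) + L * (2 * m) ^ (1 - α)
        ≤ 3 * (κ * m ^ (1 - α)) + L * (2 * m ^ (1 - α)) := by gcongr
      _ = C₁ * m ^ (1 - α) := by rw [hC₁]; ring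
      _ ≤ (C₁ + C₂) * m ^ (1 - α) := by gcongr; exact le_self_add
  · have hbot : symmDiff F ∅ = F := symmDiff_bot F
    have h := hF.perimeter_le hE hEb hne hδ hδr hα hFt hFE hasFinitePerimeter_empty
      (by rwa [hbot])
    rw [hbot, perimeter_empty, zero_add] at h
    have hx : (2 * volume F) ^ (1 - α) ≤ 1 + 2 * V := by
      rcases le_total (2 * volume F) 1 with h1 | h1
      · exact (ENNReal.rpow_le_one h1 hβ).trans le_self_add
      · calc (2 * volume F) ^ (1 - α) ≤ (2 * volume F) ^ (1 : ℝ) :=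
              ENNReal.rpow_le_rpow_of_exponent_le h1 hβ1
          _ = 2 * volume F := ENNReal.rpow_one _
          _ ≤ 2 * V := by gcongr
          _ ≤ 1 + 2 * V := le_add_self
    have hm1' : 1 ≤ m ^ (1 - α) := by
      simpa using ENNReal.rpow_le_rpow hm1 hβ
    calc perimeter F ≤ C₂ := h.trans (by rw [hC₂]; gcongr)
      _ ≤ (C₁ + C₂) * 1 := by rw [mul_one]; exact le_add_self
      _ ≤ (C₁ + C₂) * m ^ (1 - α) := by gcongr
      _ ≤ perimeter G + (C₁ + C₂) * m ^ (1 - α) := le_add_self
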